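/- Let $\alpha\in(0,1)$ be irrational and let $s=a_0a_1a_2\cdots$ be a Sturmian word of angle $\alpha$, that is, for some $\rho\in[0,1)$, $a_n=\mathtt b$ if $\{\rho+n\alpha\}\in I_{\mathtt b}$ and $a_n=\mathtt a$ if $\{\rho+n\alpha\}\in I_{\mathtt a}$, where either $I_{\mathtt b}=[0,1-\alpha)$, $I_{\mathtt a}=[1-\alpha,1)$, or $I_{\mathtt b}=(0,1-\alpha]$, $I_{\mathtt a}=(1-\alpha,1]$ (with $0$ and $1$ identified on the torus $\mathbb R/\mathbb Z$). The Parikh vector of a finite word counts the occurrences of each letter; its norm is the sum of its components; $P$ is contained in $Q$ if $P\le Q$ componentwise and the norm of $P$ is less than that of $Q$. An abelian decomposition of period $m$ of a finite word $w$ is a factorization $w=u_0u_1\cdots u_{j-1}u_j$ with $j\ge 2$ in which $u_1,\dots,u_{j-1}$ have the same Parikh vector $P$, of norm $m$, and the Parikh vectors of $u_0$ and $u_j$ are contained in $P$. The word $w$ is an abelian power of period $m$ and exponent $|w|/m$ if it has such a decomposition with $u_0$ and $u_j$ empty; it is an abelian repetition of period $m$ and exponent $|w|/m$ if it has such a decomposition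 with $j\ge 3$. Let $k_m$ (resp. $k'_m$) be the maximum exponent of an abelian power (resp. abelian repetition) of period $m$ occurring in $s$. The exponent of a finite word is its length divided by its minimum period, a repetition is a word of exponent at least $2$, and $s$ is $\beta$-power-free if no factor of $s$ is a repetition of exponent $\beta$ or larger. Then $\limsup_{m\to\infty} k_m/m=\limsup_{m\to\infty} k'_m/m$; this common value in $[0,\infty]$ is the abelian critical exponent $A(s)$ of $s$. Moreover, the following are equivalent: 1. $A(s)$ is finite; 2. $s$ is $\beta$-power-free for some real $\beta\ge 2$; 3. $\alpha$ has bounded partial quotients, that is, the partial quotients $a_i$ of its continued fraction expansion $\alpha=[a_0;a_1,a_2,\dots]$ form a bounded sequence. -/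

import Mathlib

open scoped ENNReal

noncomputable section

namespace SturmianAbelian

/-! ### Finite and infinite words -/

/-- The word `s n, s (n+1), …, s (n+l-1)`: the factor of length `l` at position `n` of the
infinite word `s`. -/
def factorAt {A : Type*} (s : ℕ → A) (n l : ℕ) : List A :=
  (List.range l).map fun i => s (n + i)

/-- The finite word `w` occurs in the infinite word `s`. -/
def IsFactor {A : Type*} (w : List A) (s : ℕ → A) : Prop :=
  ∃ n l : ℕ, w = factorAt s n l

/-! ### Ordinary periods and powers -/

/-- `p > 0` is a period of `w` if letters at distance `p` agree. -/
def HasPeriod {A : Type*} (w : List A) (p : ℕ) : Prop :=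
  0 < p ∧ ∀ i : ℕ, i + p < w.length → w[i]? = w[i + p]?

/-- The minimum period of `w` (the set is never empty, as it contains `w.length + 1`). -/
def minPeriod {A : Type*} (w : List A) : ℕ :=
  sInf {p : ℕ | HasPeriod w p}

/-- The exponent of a finite word: its length divided by its minimum period. -/
def wordExponent {A : Type*} (w : List A) : ℝ :=
  (w.length : ℝ) / (minPeriod w : ℝ)

/-- A repetition is a word of exponent at least `2`. -/
def IsRepetition {A : Type*} (w : List A) : Prop :=
  2 ≤ wordExponent w

/-- An infinite word is `β`-power-free if it contains no repetition of exponent `β` or larger. -/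
def IsPowerFree {A : Type*} (s : ℕ → A) (β : ℝ) : Prop :=
  ¬ ∃ w : List A, IsFactor w s ∧ IsRepetition w ∧ β ≤ wordExponent w

/-! ### Parikh vectors, abelian powers and abelian repetitions -/

/-- The Parikh vector of `w` counts the occurrences of every letter in `w`. -/
def parikh {A : Type*} [DecidableEq A] (w : List A) : A → ℕ :=
  fun x => w.count x

/-- The norm of a Parikh vector is the sum of its components. -/
def parikhNorm {A : Type*} [Fintype A] (P : A → ℕ) : ℕ :=
  ∑ x, P x

/-- `P` is contained in `Q`: the norm is smaller, and no component is larger. -/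
def ParikhContained {A : Type*} [Fintype A] (P Q : A → ℕ) : Prop :=
  parikhNorm P < parikhNorm Q ∧ ∀ x, P x ≤ Q x

/-- The factorization `w = head · u₁ ⋯ uᵣ · tail`, where `blocks = [u₁, …, uᵣ]` with `r ≥ 1`, is an
abelian decomposition of `w`: the blocks have the common Parikh vector `P`, and the Parikh vectors
of `head` and `tail` are contained in `P`. -/
structure IsAbelianDecomposition {A : Type*} [Fintype A] [DecidableEq A]
    (w head : List A) (blocks : List (List A)) (tail : List A) (P : A → ℕ) : Prop where
  eq_append : w = head ++ blocks.flatten ++ tail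
  one_le_length : 1 ≤ blocks.length
  parikh_block : ∀ u ∈ blocks, parikh u = P
  head_contained : ParikhContained (parikh head) P
  tail_contained : ParikhContained (parikh tail) P

/-- `w` is an abelian power of period `m`: it has an abelian decomposition of period `m` with empty
head and empty tail. (Degenerated powers, with one block, are included.) -/
def IsAbelianPower {A : Type*} [Fintype A] [DecidableEq A] (w : List A) (m : ℕ) : Prop :=
  ∃ (blocks : List (List A)) (P : A → ℕ),
    IsAbelianDecomposition w [] blocks [] P ∧ parikhNorm P = m

/-- `w` is an abelian repetition of period `m`: it has an abelian decomposition of period `m` with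
at least two blocks. -/
def IsAbelianRepetition {A : Type*} [Fintype A] [DecidableEq A] (w : List A) (m : ℕ) : Prop :=
  ∃ (head : List A) (blocks : List (List A)) (tail : List A) (P : A → ℕ),
    IsAbelianDecomposition w head blocks tail P ∧ 2 ≤ blocks.length ∧ parikhNorm P = m

/-- The maximum (as a supremum in `[0, ∞]`) of the exponents `|w| / m` of the abelian powers `w` of
period `m` occurring in `s`. -/
def maxAbelianPowerExponent {A : Type*} [Fintype A] [DecidableEq A] (s : ℕ → A) (m : ℕ) : ℝ≥0∞ :=
  ⨆ (w : List A) (_ : IsFactor w s) (_ : IsAbelianPower w m), (w.length : ℝ≥0∞) / (m : ℝ≥0∞)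

/-- The maximum (as a supremum in `[0, ∞]`) of the exponents `|w| / m` of the abelian repetitions
`w` of period `m` occurring in `s`. -/
def maxAbelianRepetitionExponent {A : Type*} [Fintype A] [DecidableEq A]
    (s : ℕ → A) (m : ℕ) : ℝ≥0∞ :=
  ⨆ (w : List A) (_ : IsFactor w s) (_ : IsAbelianRepetition w m),
    (w.length : ℝ≥0∞) / (m : ℝ≥0∞)

/-- The abelian critical exponent, computed with abelian powers. -/
def abelianCriticalExponent {A : Type*} [Fintype A] [DecidableEq A] (s : ℕ → A) : ℝ≥0∞ :=
  Filter.limsup (fun m : ℕ => maxAbelianPowerExponent s m / (m : ℝ≥0∞)) Filter.atTop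

/-- The abelian critical exponent, computed with abelian repetitions. -/
def abelianCriticalExponentRep {A : Type*} [Fintype A] [DecidableEq A] (s : ℕ → A) : ℝ≥0∞ :=
  Filter.limsup (fun m : ℕ => maxAbelianRepetitionExponent s m / (m : ℝ≥0∞)) Filter.atTop

/-! ### Sturmian words as codings of rotations -/

/-- The binary alphabet. -/
inductive Letter where
  | a : Letter
  | b : Letter
  deriving DecidableEq

instance : Fintype Letter where
  elems := {Letter.a, Letter.b}
  complete := by
    intro x
    cases x <;> simp

/-- The coding of the rotation by `α` from `ρ` with `I_b = [0, 1 - α)` and `I_a = [1 - α, 1)`. -/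
def lowerSturmian (α ρ : ℝ) : ℕ → Letter :=
  fun n => if Int.fract (ρ + n * α) < 1 - α then Letter.b else Letter.a

/-- The coding of the rotation by `α` from `ρ` with `I_b = (0, 1 - α]` and `I_a = (1 - α, 1]`; on the
torus the points `0` and `1` are the same, so the point `0` lies in `I_a`. -/
def upperSturmian (α ρ : ℝ) : ℕ → Letter :=
  fun n => if 0 < Int.fract (ρ + n * α) ∧ Int.fract (ρ + n * α) ≤ 1 - α then Letter.b else Letter.a

/-- `s` is a Sturmian word of angle `α`, with some initial point and either choice of the coding
intervals. -/
def IsSturmianWord (α : ℝ) (s : ℕ → Letter) : Prop :=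
  Irrational α ∧ α ∈ Set.Ico (0 : ℝ) 1 ∧
    ∃ ρ ∈ Set.Ico (0 : ℝ) 1, s = lowerSturmian α ρ ∨ s = upperSturmian α ρ

/-! ### Partial quotients -/

/-- The partial quotients `a₀ = ⌊α⌋, a₁, a₂, …` of the regular continued fraction expansion of `α`
are bounded. (For irrational `α` the expansion is infinite, and `aᵢ ≥ 1` for `i ≥ 1`.) -/
def HasBoundedPartialQuotients (α : ℝ) : Prop :=
  ∃ C : ℝ, (GenContFract.of α).h ≤ C ∧
    ∀ (i : ℕ) (q : ℝ), (GenContFract.of α).partDens.get? i = some q → q ≤ C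

end SturmianAbelian

end

namespace SturmianAbelian

/-! ### Badly approximable numbers -/

/-- `α` is badly approximable: `m * |m * α - p|` is bounded away from `0`. -/
def IsBadlyApproximable (α : ℝ) : Prop :=
  ∃ c : ℝ, 0 < c ∧ ∀ (m : ℕ) (p : ℤ), 0 < m → c ≤ m * |m * α - p|

theorem isBadlyApproximable_of_eventually {α c : ℝ} (hc : 0 < c) {N : ℕ}
    (h : ∀ (m : ℕ) (p : ℤ), N ≤ m → c ≤ m * |m * α - p|) : IsBadlyApproximable α := by
  refine ⟨c / ((N + 1 : ℝ) * (N + 1)), by positivity, fun m p hm => ?_⟩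
  have h1 := h ((N + 1) * m) ((N + 1) * p) (by nlinarith)
  push_cast at h1
  rw [show ((N : ℝ) + 1) * m * α - (N + 1) * p = (N + 1) * (m * α - p) by ring, abs_mul,
    abs_of_pos (by positivity : (0 : ℝ) < N + 1)] at h1
  rw [div_le_iff₀ (by positivity)]
  linarith

/-- Every `N ≥ 1` has a best approximation with denominator at most `N`. -/
theorem exists_best_approximation (α : ℝ) {N : ℕ} (hN : 0 < N) :
    ∃ (m : ℕ) (c : ℤ), 0 < m ∧ m ≤ N ∧
      ∀ (q : ℕ) (z : ℤ), 0 < q → q ≤ N → |m * α - c| ≤ |q * α - z| := by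
  obtain ⟨m, hm, hmin⟩ := Finset.exists_min_image (Finset.Icc 1 N)
    (fun q : ℕ => |(q : ℝ) * α - round ((q : ℝ) * α)|) ⟨1, by simp; omega⟩
  rw [Finset.mem_Icc] at hm
  exact ⟨m, round ((m : ℝ) * α), hm.1, hm.2, fun q z hq hqN =>
    (hmin q (Finset.mem_Icc.2 ⟨hq, hqN⟩)).trans (round_le _ z)⟩

/-- A best approximation `m` stays best up to `1 / (2 * |m * α - c|)`. -/
theorem best_approximation_extend {α : ℝ} {m : ℕ} {c : ℤ} (hm : 0 < m)
    (hbest : ∀ (q : ℕ) (z : ℤ), 0 < q → q ≤ m → |m * α - c| ≤ |q * α - z|)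
    {q : ℕ} (z : ℤ) (hq : 0 < q) (hq2 : q * |m * α - c| ≤ 1 / 2) :
    |m * α - c| ≤ |q * α - z| := by
  by_cases hqm : q ≤ m
  · exact hbest q z hq hqm
  by_contra! hlt
  have hmq : (m : ℝ) < q := by exact_mod_cast not_le.1 hqm
  have hm' : (0 : ℝ) < m := by exact_mod_cast hm
  have hq' : (0 : ℝ) < q := by exact_mod_cast hq
  have hpos : 0 < |(m : ℝ) * α - c| := (abs_nonneg _).trans_lt hlt
  have hint : ((q * c - m * z : ℤ) : ℝ) = m * (q * α - z) - q * (m * α - c) := by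
    push_cast; ring
  have habs : |((q * c - m * z : ℤ) : ℝ)| < 1 := by
    rw [hint]
    refine (abs_sub _ _).trans_lt ?_
    rw [abs_mul, abs_mul, abs_of_pos hm', abs_of_pos hq']
    nlinarith
  have hzero : (q * c - m * z : ℤ) = 0 := by
    rw [← Int.cast_abs] at habs
    exact Int.abs_lt_one_iff.1 (by exact_mod_cast habs)
  rw [hzero, Int.cast_zero] at hint
  have heq : (m : ℝ) * |q * α - z| = q * |m * α - c| := by
    rw [← abs_of_pos hm', ← abs_of_pos hq', ← abs_mul, ← abs_mul, abs_of_pos hm', abs_of_pos hq']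
    congr 1
    linarith
  nlinarith

/-! ### Bounded partial quotients -/

section

open GenContFract (of)

theorem exists_int_contsAux (α : ℝ) (n : ℕ) :
    ∃ A B : ℤ, (of α).contsAux n = ⟨A, B⟩ := by
  induction n using Nat.twoStepInduction with
  | zero => exact ⟨1, 0, by simp⟩
  | one => exact ⟨⌊α⌋, 1, by simp [GenContFract.of_h_eq_floor]⟩
  | more n h0 h1 =>
    obtain ⟨A, B, h0⟩ := h0
    obtain ⟨A', B', h1⟩ := h1
    cases hs : (of α).s.get? n with
    | none =>
      refine ⟨A', B', ?_⟩
      rw [← h1]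
      exact GenContFract.contsAux_stable_step_of_terminated hs
    | some gp =>
      obtain ⟨ha, z, hz⟩ := GenContFract.of_partNum_eq_one_and_exists_int_partDen_eq hs
      refine ⟨z * A' + A, z * B' + B, ?_⟩
      rw [GenContFract.contsAux_recurrence hs h0 h1, ha, hz]
      simp

theorem not_terminatedAt_of_irrational {α : ℝ} (hα : Irrational α) (n : ℕ) :
    ¬ (of α).TerminatedAt n := by
  intro h
  obtain ⟨q, hq⟩ := (GenContFract.terminates_iff_rat α).1 ⟨n, h⟩
  exact hα ⟨q, hq.symm⟩

theorem one_le_dens {α : ℝ} (hα : Irrational α) (n : ℕ) : 1 ≤ (of α).dens n := by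
  refine le_trans ?_ (GenContFract.succ_nth_fib_le_of_nth_den
    (Or.inr (not_terminatedAt_of_irrational hα _)))
  exact_mod_cast Nat.fib_pos.2 n.succ_pos

theorem nat_le_dens {α : ℝ} (hα : Irrational α) {n : ℕ} (hn : 5 ≤ n) : (n : ℝ) ≤ (of α).dens n := by
  refine le_trans ?_ (GenContFract.succ_nth_fib_le_of_nth_den
    (Or.inr (not_terminatedAt_of_irrational hα _)))
  exact_mod_cast (Nat.le_fib_self hn).trans Nat.fib_le_fib_succ

theorem dens_succ_le {α C : ℝ} (hα : Irrational α)
    (hC : ∀ (i : ℕ) (q : ℝ), (of α).partDens.get? i = some q → q ≤ C) (n : ℕ) :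
    (of α).dens (n + 1) ≤ (C + 1) * (of α).dens n := by
  obtain ⟨gp, hs⟩ := Option.ne_none_iff_exists'.1 (not_terminatedAt_of_irrational hα n)
  have hb : gp.b ≤ C := hC n gp.b (GenContFract.partDen_eq_s_b hs)
  have ha := (GenContFract.of_partNum_eq_one_and_exists_int_partDen_eq hs).1
  have hrec := GenContFract.contsAux_recurrence hs rfl rfl
  have h1 := one_le_dens hα n
  have hmono : ((of α).contsAux n).b ≤ (of α).dens n := by
    cases n with
    | zero => simp
    | succ k => exact GenContFract.of_den_mono
  have hden : (of α).dens (n + 1) = gp.b * (of α).dens n + gp.a * ((of α).contsAux n).b := by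
    rw [GenContFract.den_eq_conts_b, GenContFract.nth_cont_eq_succ_nth_contAux, hrec]
    rfl
  rw [hden, ha]
  nlinarith

theorem abs_dens_mul_sub_nums_le {α : ℝ} (hα : Irrational α) (n : ℕ) :
    |(of α).dens n * α - (of α).nums n| ≤ 1 / (of α).dens (n + 1) := by
  have h := GenContFract.abs_sub_convs_le (not_terminatedAt_of_irrational hα n)
  have h1 : 0 < (of α).dens n := zero_lt_one.trans_le (one_le_dens hα n)
  have h2 : 0 < (of α).dens (n + 1) := zero_lt_one.trans_le (one_le_dens hα (n + 1))
  have heq : (of α).dens n * α - (of α).nums n = (of α).dens n * (α - (of α).convs n) := by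
    rw [GenContFract.conv_eq_num_div_den]
    field_simp
  rw [heq, abs_mul, abs_of_pos h1]
  calc _ ≤ (of α).dens n * (1 / ((of α).dens n * (of α).dens (n + 1))) := by gcongr
    _ = _ := by field_simp

theorem hasBoundedPartialQuotients_of_isBadlyApproximable {α : ℝ} (hα : Irrational α)
    (h : IsBadlyApproximable α) : HasBoundedPartialQuotients α := by
  obtain ⟨c, hc, h⟩ := h
  refine ⟨max (of α).h (1 / c), le_max_left _ _, fun i q hq => le_max_of_le_right ?_⟩
  obtain ⟨A, B, hAB⟩ := exists_int_contsAux α (i + 1)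
  have hA : (of α).nums i = A := by
    rw [GenContFract.num_eq_conts_a, GenContFract.nth_cont_eq_succ_nth_contAux, hAB]
  have hB : (of α).dens i = B := by
    rw [GenContFract.den_eq_conts_b, GenContFract.nth_cont_eq_succ_nth_contAux, hAB]
  have h1 := one_le_dens hα i
  have h2 := one_le_dens hα (i + 1)
  have h3 := abs_dens_mul_sub_nums_le hα i
  have h4 := GenContFract.le_of_succ_get?_den hq
  have hB1 : (1 : ℤ) ≤ B := by rw [hB] at h1; exact_mod_cast h1
  obtain ⟨m, rfl⟩ := Int.eq_ofNat_of_zero_le (zero_le_one.trans hB1)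
  have h5 := h m A (by omega)
  have hB' : (of α).dens i = (m : ℝ) := by rw [hB]; simp
  rw [hB', hA] at h3
  rw [hB'] at h4 h1
  have h6 : c ≤ m * (1 / (of α).dens (i + 1)) := h5.trans (by gcongr)
  rw [mul_one_div, le_div_iff₀ (by linarith)] at h6
  rw [le_div_iff₀ hc]
  nlinarith

theorem isBadlyApproximable_of_hasBoundedPartialQuotients {α : ℝ} (hα : Irrational α)
    (h : HasBoundedPartialQuotients α) : IsBadlyApproximable α := by
  obtain ⟨C, -, hC⟩ := h
  have hC1 : 1 ≤ C := by
    obtain ⟨gp, hs⟩ := Option.ne_none_iff_exists'.1 (not_terminatedAt_of_irrational hα 0)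
    have hb := GenContFract.partDen_eq_s_b hs
    exact (GenContFract.of_one_le_get?_partDen hb).trans (hC 0 gp.b hb)
  refine ⟨1 / (4 * (C + 1) ^ 2), by positivity, fun m p hm => ?_⟩
  have hm' : (1 : ℝ) ≤ m := by exact_mod_cast hm
  have hex : ∃ n, 2 * (m : ℝ) ≤ (of α).dens n := by
    refine ⟨2 * m + 5, le_trans ?_ (nat_le_dens hα (by omega))⟩
    push_cast
    linarith
  have key : ∀ A B : ℤ, ∀ k : ℕ, (of α).nums k = A → (of α).dens k = B →
      2 * (m : ℝ) ≤ (of α).dens k → (m * A - p * B : ℤ) ≠ 0 →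
      1 ≤ 2 * ((of α).dens k * |m * α - p|) := by
    intro A B k hA hB hk hne
    have h1 : (1 : ℝ) ≤ |((m * A - p * B : ℤ) : ℝ)| := by
      exact_mod_cast Int.one_le_abs hne
    have h2 : ((m * A - p * B : ℤ) : ℝ) = B * (m * α - p) - m * (B * α - A) := by
      push_cast; ring
    have h3 := abs_dens_mul_sub_nums_le hα k
    have h4 : (of α).dens k ≤ (of α).dens (k + 1) := GenContFract.of_den_mono
    rw [hA, hB] at h3
    rw [h2, ← hB] at h1
    have h5 := h1.trans (abs_sub _ _)
    have hpos := one_le_dens hα k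
    rw [abs_mul, abs_mul, abs_of_pos (by linarith : 0 < (of α).dens k),
      abs_of_pos (by linarith : (0 : ℝ) < m), hB] at h5
    have h6 : (m : ℝ) * |B * α - A| ≤ 1 / 2 := by
      calc (m : ℝ) * |B * α - A| ≤ m * (1 / (of α).dens (k + 1)) := by gcongr
        _ ≤ 1 / 2 := by
          rw [mul_one_div, div_le_iff₀ (by linarith)]
          linarith
    rw [hB]
    linarith
  classical
  obtain ⟨n, hn, hmin⟩ : ∃ n, 2 * (m : ℝ) ≤ (of α).dens n ∧
      (of α).dens n ≤ (C + 1) * (2 * m) := by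
    refine ⟨Nat.find hex, Nat.find_spec hex, ?_⟩
    cases hf : Nat.find hex with
    | zero =>
      have : (of α).dens 0 = 1 := by simp
      rw [this]
      nlinarith
    | succ k =>
      have hk := Nat.find_min hex (m := k) (by omega)
      push Not at hk
      refine (dens_succ_le hα hC k).trans ?_
      gcongr
  have hn1 : (of α).dens (n + 1) ≤ (C + 1) * ((C + 1) * (2 * m)) :=
    (dens_succ_le hα hC n).trans (by gcongr)
  obtain ⟨A, B, hAB⟩ := exists_int_contsAux α (n + 1)
  have hA : (of α).nums n = A := by
    rw [GenContFract.num_eq_conts_a, GenContFract.nth_cont_eq_succ_nth_contAux, hAB]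
  have hB : (of α).dens n = B := by
    rw [GenContFract.den_eq_conts_b, GenContFract.nth_cont_eq_succ_nth_contAux, hAB]
  obtain ⟨A', B', hAB'⟩ := exists_int_contsAux α (n + 1 + 1)
  have hA' : (of α).nums (n + 1) = A' := by
    rw [GenContFract.num_eq_conts_a, GenContFract.nth_cont_eq_succ_nth_contAux, hAB']
  have hB' : (of α).dens (n + 1) = B' := by
    rw [GenContFract.den_eq_conts_b, GenContFract.nth_cont_eq_succ_nth_contAux, hAB']
  have hdet : (of α).nums n * (of α).dens (n + 1) - (of α).dens n * (of α).nums (n + 1)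
      = (-1) ^ (n + 1) :=
    SimpContFract.determinant (s := SimpContFract.of α) (not_terminatedAt_of_irrational hα n)
  have hmain : 1 ≤ 2 * ((C + 1) * ((C + 1) * (2 * m)) * |m * α - p|) := by
    by_cases h0 : (m * A - p * B : ℤ) = 0
    · have h0' : (m * A' - p * B' : ℤ) ≠ 0 := by
        intro h0'
        rw [hA, hB, hA', hB'] at hdet
        have e : (m : ℝ) * (A * B' - B * A') = 0 := by
          have e1 : (m * A - p * B : ℝ) = 0 := by exact_mod_cast h0
          have e2 : (m * A' - p * B' : ℝ) = 0 := by exact_mod_cast h0'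
          linear_combination B' * e1 - B * e2
        rw [hdet] at e
        have : ((-1 : ℝ)) ^ (n + 1) ≠ 0 := pow_ne_zero _ (by norm_num)
        rcases mul_eq_zero.1 e with h | h
        · linarith
        · exact this h
      refine (key A' B' (n + 1) hA' hB' (hn.trans GenContFract.of_den_mono) h0').trans ?_
      gcongr
    · refine (key A B n hA hB hn h0).trans ?_
      gcongr
      nlinarith
  rw [div_le_iff₀ (by positivity)]
  nlinarith

end

/-! ### Factors of infinite words -/

theorem length_factorAt {A : Type*} (s : ℕ → A) (n l : ℕ) : (factorAt s n l).length = l := by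
  simp [factorAt]

theorem factorAt_add {A : Type*} (s : ℕ → A) (n k l : ℕ) :
    factorAt s n (k + l) = factorAt s n k ++ factorAt s (n + k) l := by
  simp [factorAt, List.range_add, Function.comp_def, add_assoc]

theorem getElem?_factorAt {A : Type*} (s : ℕ → A) (n : ℕ) {l i : ℕ} (hi : i < l) :
    (factorAt s n l)[i]? = some (s (n + i)) := by
  simp [factorAt, hi]

theorem factorAt_mul {A : Type*} (s : ℕ → A) (n k m : ℕ) :
    factorAt s n (k * m) = ((List.range k).map fun j => factorAt s (n + j * m) m).flatten := by
  induction k with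
  | zero => simp [factorAt]
  | succ k ih =>
    rw [Nat.succ_mul, factorAt_add, ih, List.range_succ, List.map_append, List.flatten_append]
    simp

theorem IsFactor.of_append {A : Type*} {s : ℕ → A} {u v w : List A}
    (h : IsFactor (u ++ v ++ w) s) : IsFactor v s := by
  obtain ⟨n, l, h⟩ := h
  have hl : l = u.length + v.length + w.length := by
    simpa [length_factorAt, add_assoc] using (congrArg List.length h).symm
  rw [hl, factorAt_add, factorAt_add] at h
  have h1 := (List.append_inj' h (by simp [length_factorAt])).1
  exact ⟨_, _, (List.append_inj' h1 (by simp [length_factorAt])).2⟩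

/-! ### Parikh vectors -/

theorem parikhNorm_parikh {A : Type*} [Fintype A] [DecidableEq A] (w : List A) :
    parikhNorm (parikh w) = w.length := by
  simpa [parikhNorm, parikh] using
    Multiset.sum_count_eq_card (s := Finset.univ) (m := (w : Multiset A)) (by simp)

theorem length_flatten_of_parikh {A : Type*} [Fintype A] [DecidableEq A] {P : A → ℕ}
    {blocks : List (List A)} (h : ∀ u ∈ blocks, parikh u = P) :
    blocks.flatten.length = blocks.length * parikhNorm P := by
  rw [List.length_flatten, List.sum_eq_card_nsmul _ (parikhNorm P)]
  · simp
  · intro b hb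
    obtain ⟨u, hu, rfl⟩ := List.mem_map.1 hb
    rw [← parikhNorm_parikh, h u hu]

theorem count_flatten_of_parikh {A : Type*} [DecidableEq A] {P : A → ℕ}
    {blocks : List (List A)} (h : ∀ u ∈ blocks, parikh u = P) (x : A) :
    blocks.flatten.count x = blocks.length * P x := by
  rw [List.count_flatten, List.sum_eq_card_nsmul _ (P x)]
  · simp
  · intro b hb
    obtain ⟨u, hu, rfl⟩ := List.mem_map.1 hb
    rw [← h u hu]
    rfl

theorem parikhContained_nil {A : Type*} [Fintype A] [DecidableEq A] {P : A → ℕ}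
    (h : 0 < parikhNorm P) : ParikhContained (parikh ([] : List A)) P := by
  refine ⟨?_, fun x => by simp [parikh]⟩
  rw [parikhNorm_parikh]
  exact h

/-! ### Abelian powers and abelian repetitions -/

section

variable {A : Type*} [Fintype A] [DecidableEq A]

theorem le_maxAbelianPowerExponent {s : ℕ → A} {w : List A} {m : ℕ} (hw : IsFactor w s)
    (h : IsAbelianPower w m) : (w.length : ℝ≥0∞) / m ≤ maxAbelianPowerExponent s m :=
  le_iSup₂_of_le w hw (le_iSup_of_le h le_rfl)

theorem le_maxAbelianRepetitionExponent {s : ℕ → A} {w : List A} {m : ℕ} (hw : IsFactor w s)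
    (h : IsAbelianRepetition w m) : (w.length : ℝ≥0∞) / m ≤ maxAbelianRepetitionExponent s m :=
  le_iSup₂_of_le w hw (le_iSup_of_le h le_rfl)

theorem maxAbelianRepetitionExponent_le (s : ℕ → A) (m : ℕ) :
    maxAbelianRepetitionExponent s m ≤ maxAbelianPowerExponent s m + 2 := by
  refine iSup_le fun w => iSup_le fun hw => iSup_le fun h => ?_
  obtain ⟨u, blocks, v, P, hdec, -, rfl⟩ := h
  have hu : u.length < parikhNorm P := parikhNorm_parikh u ▸ hdec.head_contained.1
  have hv : v.length < parikhNorm P := parikhNorm_parikh v ▸ hdec.tail_contained.1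
  have hP : 0 < parikhNorm P := (Nat.zero_le _).trans_lt hu
  have hfac : IsFactor blocks.flatten s := IsFactor.of_append (hdec.eq_append ▸ hw)
  have hpow : IsAbelianPower blocks.flatten (parikhNorm P) :=
    ⟨blocks, P, ⟨by simp, hdec.one_le_length, hdec.parikh_block, parikhContained_nil hP,
      parikhContained_nil hP⟩, rfl⟩
  have hlen : w.length ≤ blocks.flatten.length + 2 * parikhNorm P := by
    rw [hdec.eq_append, List.length_append, List.length_append]
    omega
  have hP0 : (parikhNorm P : ℝ≥0∞) ≠ 0 := by exact_mod_cast hP.ne'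
  calc (w.length : ℝ≥0∞) / parikhNorm P
      ≤ (blocks.flatten.length + 2 * parikhNorm P) / parikhNorm P := by
        gcongr
        exact_mod_cast hlen
    _ = blocks.flatten.length / parikhNorm P + 2 := by
        rw [ENNReal.add_div, ENNReal.mul_div_cancel_right hP0 (ENNReal.natCast_ne_top _)]
    _ ≤ _ := by
        gcongr
        exact le_maxAbelianPowerExponent hfac hpow

theorem maxAbelianPowerExponent_le (s : ℕ → A) (m : ℕ) :
    maxAbelianPowerExponent s m ≤ maxAbelianRepetitionExponent s m + 2 := by
  refine iSup_le fun w => iSup_le fun hw => iSup_le fun h => ?_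
  obtain ⟨blocks, P, hdec, rfl⟩ := h
  have hP : 0 < parikhNorm P := (Nat.zero_le _).trans_lt hdec.head_contained.1
  have hP0 : (parikhNorm P : ℝ≥0∞) ≠ 0 := by exact_mod_cast hP.ne'
  by_cases h2 : 2 ≤ blocks.length
  · exact (le_maxAbelianRepetitionExponent hw ⟨[], blocks, [], P, hdec, h2, rfl⟩).trans le_self_add
  · refine le_trans ?_ le_add_self
    have hlen : w.length ≤ 2 * parikhNorm P := by
      have hw' : w = blocks.flatten := by simpa using hdec.eq_append
      rw [hw', length_flatten_of_parikh hdec.parikh_block]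
      exact Nat.mul_le_mul_right _ (by omega)
    rw [ENNReal.div_le_iff hP0 (ENNReal.natCast_ne_top _)]
    exact_mod_cast hlen

end

open Filter in
theorem limsup_div_le_of_le_add {f g : ℕ → ℝ≥0∞} (h : ∀ m, f m ≤ g m + 2) :
    limsup (fun m : ℕ => f m / (m : ℝ≥0∞)) atTop ≤
      limsup (fun m : ℕ => g m / (m : ℝ≥0∞)) atTop := by
  refine le_of_forall_gt fun c hc => ?_
  obtain ⟨c', hc', hcc⟩ := exists_between hc
  obtain ⟨d, hd, hdc⟩ := exists_between hcc
  have h1 : ∀ᶠ m : ℕ in atTop, g m / (m : ℝ≥0∞) < c' := eventually_lt_of_limsup_lt hc'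
  have h2 : ∀ᶠ m : ℕ in atTop, 2 / (m : ℝ≥0∞) < d - c' := by
    have ht := ENNReal.Tendsto.const_div ENNReal.tendsto_nat_nhds_top
      (Or.inr (ENNReal.ofNat_ne_top (n := 2)))
    rw [ENNReal.div_top] at ht
    exact ht.eventually_lt_const (tsub_pos_of_lt hd)
  refine lt_of_le_of_lt (limsup_le_of_le (by isBoundedDefault) ?_) hdc
  filter_upwards [h1, h2] with m hm1 hm2
  calc f m / (m : ℝ≥0∞) ≤ (g m + 2) / m := by gcongr; exact h m
    _ = g m / m + 2 / m := ENNReal.add_div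
    _ ≤ c' + (d - c') := add_le_add hm1.le hm2.le
    _ = d := add_tsub_cancel_of_le hd.le

theorem abelianCriticalExponent_eq_abelianCriticalExponentRep {A : Type*} [Fintype A]
    [DecidableEq A] (s : ℕ → A) : abelianCriticalExponent s = abelianCriticalExponentRep s :=
  le_antisymm (limsup_div_le_of_le_add (maxAbelianPowerExponent_le s))
    (limsup_div_le_of_le_add (maxAbelianRepetitionExponent_le s))

/-! ### Height functions of Sturmian words -/

/-- `F` counts, up to an additive constant, the letters `a` in the prefixes of `s`; it stays close
to a line of slope `α`, and the places where its increment over `m` steps is not `c` are all close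
to each other modulo `1`. -/
structure IsHeight (α : ℝ) (s : ℕ → Letter) (F : ℕ → ℤ) : Prop where
  step : ∀ n, F (n + 1) - F n = if s n = Letter.a then 1 else 0
  balanced : ∀ n l : ℕ, |((F (n + l) - F n : ℤ) : ℝ) - l * α| < 1
  spacing : ∀ (i j m : ℕ) (c : ℤ), F (i + m) ≠ F i + c → F (j + m) ≠ F j + c →
    ∃ z : ℤ, |((j : ℝ) - i) * α - z| < |m * α - c|

theorem exists_int_of_floor_add_ne {x ε : ℝ} (h : ⌊x + ε⌋ ≠ ⌊x⌋) :
    ∃ z : ℤ, (x < z ∧ z ≤ x + ε) ∨ (x + ε < z ∧ z ≤ x) := by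
  rcases lt_or_gt_of_ne h with h | h
  · exact ⟨⌊x⌋, Or.inr ⟨Int.floor_lt.1 h, Int.floor_le x⟩⟩
  · exact ⟨⌊x + ε⌋, Or.inl ⟨Int.floor_lt.1 h, Int.floor_le _⟩⟩

theorem floor_spacing {x y ε : ℝ} (hx : ⌊x + ε⌋ ≠ ⌊x⌋) (hy : ⌊y + ε⌋ ≠ ⌊y⌋) :
    ∃ z : ℤ, |y - x - z| < |ε| := by
  obtain ⟨z, hz⟩ := exists_int_of_floor_add_ne hx
  obtain ⟨w, hw⟩ := exists_int_of_floor_add_ne hy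
  refine ⟨w - z, ?_⟩
  push_cast
  rcases hz with ⟨h1, h2⟩ | ⟨h1, h2⟩ <;> rcases hw with ⟨h3, h4⟩ | ⟨h3, h4⟩
  · rw [abs_of_pos (by linarith : 0 < ε), abs_lt]
    constructor <;> linarith
  · linarith
  · linarith
  · rw [abs_of_neg (by linarith : ε < 0), abs_lt]
    constructor <;> linarith

theorem isHeight_lowerSturmian {α : ℝ} (hα : α ∈ Set.Ico (0 : ℝ) 1) (ρ : ℝ) :
    IsHeight α (lowerSturmian α ρ) fun n => ⌊ρ + n * α⌋ where
  step n := by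
    have h0 := Int.fract_nonneg (ρ + n * α)
    have h1 := Int.fract_lt_one (ρ + n * α)
    have h2 := Int.floor_add_fract (ρ + n * α)
    have h3 : ρ + ((n + 1 : ℕ) : ℝ) * α = ρ + n * α + α := by push_cast; ring
    rw [lowerSturmian, h3]
    split_ifs with h4 h5 h5
    · cases h5
    · rw [sub_eq_zero, Int.floor_eq_iff]
      constructor <;> linarith [hα.1]
    · rw [sub_eq_iff_eq_add, Int.floor_eq_iff]
      push_cast
      constructor <;> linarith [hα.2]
    · exact absurd rfl h5
  balanced n l := by
    push_cast
    rw [abs_lt]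
    have h1 := Int.floor_le (ρ + n * α)
    have h2 := Int.lt_floor_add_one (ρ + n * α)
    have h3 := Int.floor_le (ρ + (n + l : ℝ) * α)
    have h4 := Int.lt_floor_add_one (ρ + (n + l : ℝ) * α)
    constructor <;> linarith
  spacing i j m c hi hj := by
    have key : ∀ i : ℕ, ⌊ρ + ((i + m : ℕ) : ℝ) * α⌋ ≠ ⌊ρ + i * α⌋ + c →
        ⌊ρ + i * α + (m * α - c)⌋ ≠ ⌊ρ + i * α⌋ := by
      intro i hi h
      apply hi
      rw [← h, ← Int.floor_add_intCast]
      push_cast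
      congr 1
      ring
    obtain ⟨z, hz⟩ := floor_spacing (key i hi) (key j hj)
    exact ⟨z, by convert hz using 2; ring⟩

theorem isHeight_upperSturmian {α : ℝ} (hα : α ∈ Set.Ico (0 : ℝ) 1) (hα0 : α ≠ 0) (ρ : ℝ) :
    IsHeight α (upperSturmian α ρ) fun n => ⌈ρ + n * α⌉ where
  step n := by
    have hpos : 0 < α := hα.1.lt_of_ne' hα0
    have h0 := Int.fract_nonneg (ρ + n * α)
    have h1 := Int.fract_lt_one (ρ + n * α)
    have h2 := Int.floor_add_fract (ρ + n * α)
    have h3 : ρ + ((n + 1 : ℕ) : ℝ) * α = ρ + n * α + α := by push_cast; ring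
    rw [upperSturmian, h3]
    rcases h0.eq_or_lt with hz | hz
    · have e1 : ⌈ρ + n * α⌉ = ⌊ρ + n * α⌋ := by
        rw [Int.ceil_eq_iff]
        constructor <;> linarith
      have e2 : ⌈ρ + n * α + α⌉ = ⌊ρ + n * α⌋ + 1 := by
        rw [Int.ceil_eq_iff]
        push_cast
        constructor <;> linarith [hα.2]
      simp [e1, e2, ← hz]
    · have e1 : ⌈ρ + n * α⌉ = ⌊ρ + n * α⌋ + 1 := by
        rw [Int.ceil_eq_iff]
        push_cast
        constructor <;> linarith
      by_cases h4 : Int.fract (ρ + n * α) ≤ 1 - α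
      · have e2 : ⌈ρ + n * α + α⌉ = ⌊ρ + n * α⌋ + 1 := by
          rw [Int.ceil_eq_iff]
          push_cast
          constructor <;> linarith
        simp [e1, e2, hz, h4]
      · have e2 : ⌈ρ + n * α + α⌉ = ⌊ρ + n * α⌋ + 1 + 1 := by
          push Not at h4
          rw [Int.ceil_eq_iff]
          push_cast
          constructor <;> linarith [hα.2]
        simp [e1, e2, h4]
  balanced n l := by
    push_cast
    rw [abs_lt]
    have h1 := Int.le_ceil (ρ + n * α)
    have h2 := Int.ceil_lt_add_one (ρ + n * α)
    have h3 := Int.le_ceil (ρ + (n + l : ℝ) * α)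
    have h4 := Int.ceil_lt_add_one (ρ + (n + l : ℝ) * α)
    constructor <;> linarith
  spacing i j m c hi hj := by
    have key : ∀ i : ℕ, ⌈ρ + ((i + m : ℕ) : ℝ) * α⌉ ≠ ⌈ρ + i * α⌉ + c →
        ⌊-(ρ + i * α) + -(m * α - c)⌋ ≠ ⌊-(ρ + i * α)⌋ := by
      intro i hi h
      apply hi
      rw [← neg_add, Int.floor_neg, Int.floor_neg, neg_inj] at h
      rw [← h, ← Int.ceil_add_intCast]
      push_cast
      congr 1
      ring
    obtain ⟨z, hz⟩ := floor_spacing (key i hi) (key j hj)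
    refine ⟨-z, ?_⟩
    rw [abs_neg, ← abs_neg] at hz
    convert hz using 2
    push_cast
    ring

theorem IsSturmianWord.exists_isHeight {α : ℝ} {s : ℕ → Letter} (hs : IsSturmianWord α s) :
    ∃ F, IsHeight α s F := by
  obtain ⟨hirr, hα, ρ, -, rfl | rfl⟩ := hs
  · exact ⟨_, isHeight_lowerSturmian hα ρ⟩
  · exact ⟨_, isHeight_upperSturmian hα hirr.ne_zero ρ⟩

theorem abs_sum_le_one_of_sparse {d : ℕ → ℤ} {p : ℕ} (h1 : ∀ i, |d i| ≤ 1)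
    (h2 : ∀ i j, i < j → j < p → d i ≠ 0 → d j ≠ 0 → False) :
    |∑ i ∈ Finset.range p, d i| ≤ 1 := by
  by_cases hall : ∀ i ∈ Finset.range p, d i = 0
  · rw [Finset.sum_eq_zero hall]
    simp
  · push Not at hall
    obtain ⟨i, hi, hdi⟩ := hall
    rw [Finset.sum_eq_single_of_mem i hi]
    · exact h1 i
    · intro j hj hji
      by_contra hdj
      rcases lt_or_gt_of_ne hji with hlt | hlt
      · exact h2 j i hlt (Finset.mem_range.1 hi) hdj hdi
      · exact h2 i j hlt (Finset.mem_range.1 hj) hdi hdj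

theorem sum_increments_comm (G : ℕ → ℤ) (p q : ℕ) :
    ∑ i ∈ Finset.range q, (G (p + i) - G i) = ∑ i ∈ Finset.range p, (G (q + i) - G i) := by
  have h1 := Finset.sum_range_add G p q
  have h2 := Finset.sum_range_add G q p
  rw [add_comm q p] at h2
  rw [Finset.sum_sub_distrib, Finset.sum_sub_distrib]
  linarith

namespace IsHeight

variable {α : ℝ} {s : ℕ → Letter} {F : ℕ → ℤ}

theorem count_factorAt (hF : IsHeight α s F) (n l : ℕ) :
    ((factorAt s n l).count Letter.a : ℤ) = F (n + l) - F n := by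
  induction l with
  | zero => simp [factorAt]
  | succ l ih =>
    have h := hF.step (n + l)
    rw [factorAt_add, List.count_append, Nat.cast_add, ih, ← add_assoc]
    have : factorAt s (n + l) 1 = [s (n + l)] := by simp [factorAt]
    rw [this, List.count_singleton]
    by_cases hsn : s (n + l) = Letter.a <;> simp [hsn] at h ⊢ <;> omega

theorem parikh_factorAt_eq (hF : IsHeight α s F) {i j m : ℕ}
    (h : F (i + m) - F i = F (j + m) - F j) :
    parikh (factorAt s i m) = parikh (factorAt s j m) := by
  have ha : (factorAt s i m).count Letter.a = (factorAt s j m).count Letter.a := by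
    have := hF.count_factorAt i m
    have := hF.count_factorAt j m
    omega
  have hsum : ∀ w : List Letter, w.count Letter.a + w.count Letter.b = w.length := by
    intro w
    rw [← parikhNorm_parikh w]
    rfl
  have h1 := hsum (factorAt s i m)
  have h2 := hsum (factorAt s j m)
  rw [length_factorAt] at h1 h2
  funext x
  cases x
  · exact ha
  · change List.count _ _ = List.count _ _
    omega

theorem eq_of_forall_increment_eq (hF : IsHeight α s F) {n m h : ℕ} {c : ℤ}
    (hc : ∀ i ≤ h, F (n + i + m) = F (n + i) + c) {i : ℕ} (hi : i < h) :
    s (n + i) = s (n + i + m) := by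
  have h1 := hc i hi.le
  have h2 := hc (i + 1) hi
  have h3 := hF.step (n + i)
  have h4 := hF.step (n + i + m)
  have e1 : n + (i + 1) + m = n + i + m + 1 := by ring
  rw [e1, ← add_assoc] at h2
  cases hx : s (n + i) <;> cases hy : s (n + i + m) <;> simp [hx, hy] at h3 h4 ⊢ <;> omega

theorem increment_eq_of_forall_eq (hF : IsHeight α s F) {n m h : ℕ}
    (hs : ∀ i < h, s (n + i) = s (n + i + m)) {i : ℕ} (hi : i ≤ h) :
    F (n + i + m) - F (n + i) = F (n + m) - F n := by
  induction i with
  | zero => rfl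
  | succ i ih =>
    have h1 := ih (by omega)
    have h3 := hF.step (n + i)
    have h4 := hF.step (n + i + m)
    rw [← hs i (by omega)] at h4
    have e1 : n + (i + 1) + m = n + i + m + 1 := by ring
    rw [e1, ← add_assoc]
    omega

/-! ### Abelian powers in Sturmian words -/

theorem exists_of_isAbelianPower (hF : IsHeight α s F) {w : List Letter} {m : ℕ}
    (hw : IsFactor w s) (h : IsAbelianPower w m) :
    ∃ (k : ℕ) (c : ℤ), 0 < m ∧ w.length = k * m ∧ k * |m * α - c| < 1 := by
  obtain ⟨blocks, P, hdec, rfl⟩ := h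
  have hP : 0 < parikhNorm P := (Nat.zero_le _).trans_lt hdec.head_contained.1
  have hw' : w = blocks.flatten := by simpa using hdec.eq_append
  have hlen := length_flatten_of_parikh hdec.parikh_block
  have hcount := count_flatten_of_parikh hdec.parikh_block Letter.a
  rw [← hw'] at hlen hcount
  refine ⟨blocks.length, P Letter.a, hP, hlen, ?_⟩
  obtain ⟨n, l, rfl⟩ := hw
  rw [length_factorAt] at hlen
  have h1 := hF.balanced n l
  rw [← hF.count_factorAt, hcount, hlen] at h1
  rw [abs_sub_comm] at h1
  push_cast at h1
  rwa [mul_assoc, ← mul_sub, abs_mul, abs_of_nonneg (Nat.cast_nonneg _)] at h1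

theorem maxAbelianPowerExponent_le (hF : IsHeight α s F) {c : ℝ} (hc : 0 < c)
    (h : ∀ (m : ℕ) (p : ℤ), 0 < m → c ≤ m * |m * α - p|) (m : ℕ) :
    maxAbelianPowerExponent s m ≤ ENNReal.ofReal (1 / c) * m := by
  refine iSup_le fun w => iSup_le fun hw => iSup_le fun hpow => ?_
  obtain ⟨k, p, hm, hlen, hk⟩ := hF.exists_of_isAbelianPower hw hpow
  have hm0 : (m : ℝ≥0∞) ≠ 0 := by exact_mod_cast hm.ne'
  have hm' : (0 : ℝ) < m := by exact_mod_cast hm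
  rw [hlen, Nat.cast_mul, ENNReal.mul_div_cancel_right hm0 (ENNReal.natCast_ne_top _),
    ← ENNReal.ofReal_natCast k, ← ENNReal.ofReal_natCast m, ← ENNReal.ofReal_mul (by positivity)]
  refine ENNReal.ofReal_le_ofReal ?_
  have h1 := h m p hm
  have h2 : (k : ℝ) * c ≤ k * (m * |m * α - p|) := by gcongr
  rw [one_div_mul_eq_div, le_div_iff₀ hc]
  nlinarith

theorem exists_run (hF : IsHeight α s F) {m k : ℕ} {c : ℤ}
    (h : (2 * k + 1) * |m * α - c| < 1) :
    ∃ n, ∀ j < k, F (n + j * m + m) = F (n + j * m) + c := by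
  have key : ∀ i j : ℕ, i < j → j < 2 * k →
      F (i * m + m) ≠ F (i * m) + c → F (j * m + m) ≠ F (j * m) + c → False := by
    intro i j hij hj hbi hbj
    obtain ⟨z, hz⟩ := hF.spacing _ _ m c hbi hbj
    obtain ⟨d, rfl⟩ := Nat.exists_eq_add_of_lt hij
    have hd : (1 : ℝ) ≤ d + 1 := by linarith [Nat.cast_nonneg (α := ℝ) d]
    have hdk : (d : ℝ) + 1 ≤ 2 * k := by exact_mod_cast (by omega : d + 1 ≤ 2 * k)
    have e : (((i + d + 1) * m : ℕ) - (i * m : ℕ) : ℝ) * α - z =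
        (d + 1) * (m * α - c) - (z - (d + 1) * c : ℤ) := by
      push_cast; ring
    rw [e] at hz
    have h0 : (z - (d + 1) * c : ℤ) = 0 := by
      have h1 : |((z - (d + 1) * c : ℤ) : ℝ)| < 1 := by
        have h2 := abs_sub_abs_le_abs_sub ((z - (d + 1) * c : ℤ) : ℝ) ((d + 1) * (m * α - c))
        rw [abs_sub_comm, abs_mul, abs_of_pos (by linarith : (0 : ℝ) < d + 1)] at h2
        nlinarith [abs_nonneg ((m : ℝ) * α - c)]
      rw [← Int.cast_abs] at h1
      exact Int.abs_lt_one_iff.1 (by exact_mod_cast h1)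
    rw [h0, Int.cast_zero, sub_zero, abs_mul, abs_of_pos (by linarith : (0 : ℝ) < d + 1)] at hz
    nlinarith [abs_nonneg ((m : ℝ) * α - c)]
  by_cases hall : ∀ j < k, F (j * m + m) = F (j * m) + c
  · exact ⟨0, by simpa using hall⟩
  · push Not at hall
    obtain ⟨i, hi, hbi⟩ := hall
    refine ⟨k * m, fun j hj => ?_⟩
    by_contra hbj
    rw [← add_mul] at hbj
    exact key i (k + j) (by omega) (by omega) hbi hbj

theorem le_maxAbelianPowerExponent (hF : IsHeight α s F) {m k : ℕ} {c : ℤ} (hm : 0 < m)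
    (hk : 0 < k) (h : (2 * k + 1) * |m * α - c| < 1) :
    (k : ℝ≥0∞) ≤ maxAbelianPowerExponent s m := by
  obtain ⟨n, hn⟩ := hF.exists_run h
  have hP : parikhNorm (parikh (factorAt s n m)) = m := by
    rw [parikhNorm_parikh, length_factorAt]
  have hpow : IsAbelianPower (factorAt s n (k * m)) m := by
    refine ⟨(List.range k).map fun j => factorAt s (n + j * m) m, parikh (factorAt s n m),
      ⟨by simp [factorAt_mul], by simpa using Nat.succ_le_of_lt hk, ?_, parikhContained_nil (hP.symm ▸ hm),
        parikhContained_nil (hP.symm ▸ hm)⟩, hP⟩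
    intro u hu
    obtain ⟨j, hj, rfl⟩ := List.mem_map.1 hu
    refine hF.parikh_factorAt_eq ?_
    have h1 := hn j (List.mem_range.1 hj)
    have h2 := hn 0 hk
    simp only [zero_mul, add_zero] at h2
    omega
  have h1 := SturmianAbelian.le_maxAbelianPowerExponent ⟨n, k * m, rfl⟩ hpow
  rwa [length_factorAt, Nat.cast_mul, ENNReal.mul_div_cancel_right
    (by exact_mod_cast hm.ne') (ENNReal.natCast_ne_top _)] at h1

theorem abelianCriticalExponent_lt_top_iff (hF : IsHeight α s F) :
    abelianCriticalExponent s < ⊤ ↔ IsBadlyApproximable α := by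
  constructor
  · intro h
    obtain ⟨K, hK, hKt⟩ := exists_between h
    obtain ⟨N, hN⟩ := Filter.eventually_atTop.1 (Filter.eventually_lt_of_limsup_lt hK)
    lift K to NNReal using hKt.ne
    refine isBadlyApproximable_of_eventually (c := 1 / (2 * K + 5)) (by positivity) (N := N + 1)
      fun m p hm => ?_
    by_contra! hlt
    have hm0 : 0 < m := by omega
    have hm1 : (1 : ℝ) ≤ m := by exact_mod_cast hm0
    have hkub := Nat.ceil_lt_add_one (show (0 : ℝ) ≤ K * m by positivity)
    have hklb := Nat.le_ceil ((K : ℝ) * m)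
    set k := ⌈(K : ℝ) * m⌉₊ + 1 with hk
    have hpow := hF.le_maxAbelianPowerExponent (m := m) (k := k) (c := p) hm0 (by omega) (by
      rw [lt_div_iff₀ (by positivity)] at hlt
      refine lt_of_le_of_lt ?_ hlt
      have : (2 * k + 1 : ℝ) ≤ m * (2 * K + 5) := by
        rw [hk]
        push_cast
        nlinarith
      calc (2 * k + 1 : ℝ) * |m * α - p| ≤ m * (2 * K + 5) * |m * α - p| := by gcongr
        _ = _ := by ring)
    have h1 := hN m (by omega)
    rw [ENNReal.div_lt_iff (Or.inl (by exact_mod_cast hm0.ne'))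
      (Or.inl (ENNReal.natCast_ne_top _))] at h1
    have h2 : (k : ℝ) < K * m := by exact_mod_cast hpow.trans_lt h1
    rw [hk] at h2
    push_cast at h2
    linarith
  · rintro ⟨c, hc, h⟩
    refine lt_of_le_of_lt (Filter.limsup_le_of_le (a := ENNReal.ofReal (1 / c))
      (by isBoundedDefault) (Filter.Eventually.of_forall fun m => ?_)) ENNReal.ofReal_lt_top
    exact ENNReal.div_le_of_le_mul (hF.maxAbelianPowerExponent_le hc h m)

/-! ### Ordinary powers in Sturmian words -/

theorem not_isPowerFree (hF : IsHeight α s F) (h : ¬ IsBadlyApproximable α) {β : ℝ}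
    (hβ : 2 ≤ β) : ¬ IsPowerFree s β := by
  rw [IsPowerFree, not_not]
  unfold IsBadlyApproximable at h
  push Not at h
  obtain ⟨m', p', hm', hlt⟩ := h (1 / (4 * β + 8)) (by positivity)
  obtain ⟨m, c, hm, hmm, hbest⟩ := exists_best_approximation α hm'
  have hm1 : (1 : ℝ) ≤ m := by exact_mod_cast hm
  have hmm' : (m : ℝ) ≤ m' := by exact_mod_cast hmm
  have hsmall : (m : ℝ) * |m * α - c| < 1 / (4 * β + 8) :=
    lt_of_le_of_lt (mul_le_mul hmm' (hbest m' p' hm' le_rfl) (abs_nonneg _) (by positivity)) hlt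
  rw [lt_div_iff₀ (by positivity)] at hsmall
  have hhub := Nat.ceil_lt_add_one (show (0 : ℝ) ≤ β * m by positivity)
  have hhlb := Nat.le_ceil (β * m)
  set h := ⌈β * m⌉₊
  have hspace : ∀ i j : ℕ, i < j → j < 2 * (h + 1) →
      F (i + m) ≠ F i + c → F (j + m) ≠ F j + c → False := by
    intro i j hij hj hbi hbj
    obtain ⟨z, hz⟩ := hF.spacing i j m c hbi hbj
    obtain ⟨q, hq, rfl⟩ : ∃ q, 0 < q ∧ j = i + q := ⟨j - i, by omega, by omega⟩
    have hqh : (q : ℝ) ≤ 2 * (h + 1) := by exact_mod_cast (by omega : q ≤ 2 * (h + 1))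
    refine absurd hz (not_lt.2 ?_)
    rw [show ((i + q : ℕ) : ℝ) - i = q by push_cast; ring]
    refine best_approximation_extend hm (fun q' z' h1 h2 => hbest q' z' h1 (h2.trans hmm)) z hq ?_
    have : (q : ℝ) ≤ m * (2 * β + 4) := by nlinarith
    calc (q : ℝ) * |m * α - c| ≤ m * (2 * β + 4) * |m * α - c| := by gcongr
      _ ≤ 1 / 2 := by linarith
  obtain ⟨n, hn⟩ : ∃ n, ∀ i ≤ h, F (n + i + m) = F (n + i) + c := by
    by_cases hall : ∀ i ≤ h, F (i + m) = F i + c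
    · exact ⟨0, by simpa using hall⟩
    · push Not at hall
      obtain ⟨i, hi, hbi⟩ := hall
      refine ⟨h + 1, fun j hj => ?_⟩
      by_contra hbj
      exact hspace i (h + 1 + j) (by omega) (by omega) hbi hbj
  have hper : HasPeriod (factorAt s n (h + m)) m := by
    refine ⟨hm, fun i hi => ?_⟩
    rw [length_factorAt] at hi
    rw [getElem?_factorAt _ _ (by omega), getElem?_factorAt _ _ hi, ← add_assoc,
      hF.eq_of_forall_increment_eq hn (by omega)]
  have hmin : minPeriod (factorAt s n (h + m)) ≤ m := Nat.sInf_le hper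
  have hpos : 0 < minPeriod (factorAt s n (h + m)) :=
    (Nat.sInf_mem (s := {p | HasPeriod (factorAt s n (h + m)) p}) ⟨m, hper⟩).1
  have hexp : β ≤ wordExponent (factorAt s n (h + m)) := by
    have hmin' : (minPeriod (factorAt s n (h + m)) : ℝ) ≤ m := by exact_mod_cast hmin
    rw [wordExponent, length_factorAt, le_div_iff₀ (by exact_mod_cast hpos)]
    push_cast
    nlinarith
  exact ⟨_, ⟨n, h + m, rfl⟩, hβ.trans hexp, hexp⟩

/-- If the increment of the height over `p` steps is constant along a run of length `q`, where `q`
is a best approximation of order at least `p`, then `p * α` is within `2 / q` of that increment. -/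
theorem mul_abs_le_of_run (hF : IsHeight α s F) {p q N n : ℕ} {c C : ℤ} (hpN : p ≤ N)
    (hN : 0 < N)
    (hbest : ∀ (k : ℕ) (z : ℤ), 0 < k → k ≤ N → |q * α - c| ≤ |k * α - z|)
    (hrun : ∀ i < q, F (n + i + p) - F (n + i) = C) :
    q * |p * α - C| ≤ 2 := by
  have hN' : (0 : ℝ) < N := by exact_mod_cast hN
  have hsmall : |q * α - c| ≤ 1 / (N + 1) := by
    obtain ⟨k, hk0, hkN, hk⟩ := Real.exists_nat_abs_mul_sub_round_le α hN
    exact (hbest k _ hk0 hkN).trans hk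
  have hlt1 : |q * α - c| < 1 := hsmall.trans_lt (by
    rw [div_lt_one (by positivity)]; linarith)
  have hp : (p : ℝ) * |q * α - c| ≤ 1 := by
    have hpN' : (p : ℝ) ≤ N := by exact_mod_cast hpN
    calc (p : ℝ) * |q * α - c| ≤ N * (1 / (N + 1)) := by gcongr
      _ ≤ 1 := by rw [mul_one_div, div_le_one (by positivity)]; linarith
  have hsum := sum_increments_comm (fun i => F (n + i)) p q
  have hleft : ∑ i ∈ Finset.range q, (F (n + (p + i)) - F (n + i)) = q * C := by
    rw [Finset.sum_congr rfl fun i hi => ?_, Finset.sum_const, Finset.card_range, nsmul_eq_mul]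
    rw [add_comm p i, ← add_assoc]
    exact hrun i (Finset.mem_range.1 hi)
  have hdev : |∑ i ∈ Finset.range p, (F (n + (q + i)) - F (n + i) - c)| ≤ 1 := by
    refine abs_sum_le_one_of_sparse (fun i => ?_) fun i j hij hj hi0 hj0 => ?_
    · have h1 := hF.balanced (n + i) q
      have h2 : |((F (n + (q + i)) - F (n + i) - c : ℤ) : ℝ)| < 2 := by
        rw [add_comm q i, ← add_assoc]
        push_cast at h1 ⊢
        rw [abs_lt] at *
        constructor <;> linarith
      rw [← Int.cast_abs] at h2
      have h3 : |F (n + (q + i)) - F (n + i) - c| < 2 := by exact_mod_cast h2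
      omega
    · obtain ⟨z, hz⟩ := hF.spacing (n + i) (n + j) q c
        (by intro h; apply hi0; rw [add_comm q i, ← add_assoc, h]; ring)
        (by intro h; apply hj0; rw [add_comm q j, ← add_assoc, h]; ring)
      obtain ⟨k, hk, rfl⟩ : ∃ k, 0 < k ∧ j = i + k := ⟨j - i, by omega, by omega⟩
      rw [show ((n + (i + k) : ℕ) : ℝ) - (n + i : ℕ) = k by push_cast; ring] at hz
      exact absurd hz (not_lt.2 (hbest k z hk (by omega)))
  rw [Finset.sum_sub_distrib, ← hsum, hleft, Finset.sum_const, Finset.card_range,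
    nsmul_eq_mul] at hdev
  have hdev' : |(q * C - p * c : ℝ)| ≤ 1 := by exact_mod_cast hdev
  calc (q : ℝ) * |p * α - C| = |q * (p * α - C)| := by
        rw [abs_mul, abs_of_nonneg (Nat.cast_nonneg (α := ℝ) q)]
    _ = |p * (q * α - c) - (q * C - p * c)| := by congr 1; ring
    _ ≤ |p * (q * α - c)| + |(q * C - p * c : ℝ)| := abs_sub _ _
    _ = p * |q * α - c| + |(q * C - p * c : ℝ)| := by
        rw [abs_mul, abs_of_nonneg (Nat.cast_nonneg (α := ℝ) p)]
    _ ≤ 2 := by linarith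

theorem exists_isPowerFree (hF : IsHeight α s F) (h : IsBadlyApproximable α) :
    ∃ β : ℝ, 2 ≤ β ∧ IsPowerFree s β := by
  obtain ⟨c, hc, h⟩ := h
  refine ⟨4 + 2 / c ^ 2, by linarith [show 0 < 2 / c ^ 2 by positivity], ?_⟩
  rintro ⟨w, ⟨n, l, rfl⟩, hrep, hexp⟩
  have hne : {p : ℕ | HasPeriod (factorAt s n l) p}.Nonempty :=
    ⟨l + 1, by omega, fun i hi => by rw [length_factorAt] at hi; omega⟩
  have hmin : HasPeriod (factorAt s n l) (minPeriod (factorAt s n l)) := Nat.sInf_mem hne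
  rw [wordExponent, length_factorAt] at hexp
  set p := minPeriod (factorAt s n l)
  obtain ⟨hp, hper⟩ := hmin
  rw [length_factorAt] at hper
  have hp1 : (1 : ℝ) ≤ p := by exact_mod_cast hp
  rw [le_div_iff₀ (by linarith)] at hexp
  have hNub := Nat.ceil_lt_add_one (show (0 : ℝ) ≤ (2 / c ^ 2 + 1) * p by positivity)
  have hNlb := Nat.le_ceil ((2 / c ^ 2 + 1) * (p : ℝ))
  set N := ⌈(2 / c ^ 2 + 1) * (p : ℝ)⌉₊
  have hpN' : (p : ℝ) ≤ N := by nlinarith [show 0 < 2 / c ^ 2 by positivity]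
  have hpN : p ≤ N := by exact_mod_cast hpN'
  obtain ⟨q, d, hq, hqN, hbest⟩ := exists_best_approximation α (hp.trans_le hpN)
  have hlen : N + p ≤ l := by
    have : (N : ℝ) + p ≤ l := by nlinarith
    exact_mod_cast this
  have hrun : ∀ i < q, F (n + i + p) - F (n + i) = F (n + p) - F n := fun i hi =>
    hF.increment_eq_of_forall_eq (h := N) (fun j hj => by
      have := hper j (by omega)
      rw [getElem?_factorAt _ _ (by omega), getElem?_factorAt _ _ (by omega), ← add_assoc] at this
      exact Option.some_injective _ this) (by omega)
  have h1 := hF.mul_abs_le_of_run hpN (hp.trans_le hpN) hbest hrun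
  have h2 := h p (F (n + p) - F n) hp
  obtain ⟨k, hk0, hkN, hk⟩ := Real.exists_nat_abs_mul_sub_round_le α (hp.trans_le hpN)
  have h3 := (hbest k _ hk0 hkN).trans hk
  have h4 := h q d hq
  have hN1 : (0 : ℝ) < N + 1 := by positivity
  rw [le_div_iff₀ hN1] at h3
  have hq' : (0 : ℝ) < q := by exact_mod_cast hq
  have h5 : (q : ℝ) * c ≤ 2 * p := by nlinarith
  have h6 : c * (N + 1) ≤ q := by nlinarith
  have h7 : c ^ 2 * (N + 1) ≤ 2 * p := by nlinarith
  have h8 : 2 * (p : ℝ) = c ^ 2 * (2 / c ^ 2 * p) := by field_simp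
  have h9 : (2 / c ^ 2) * (p : ℝ) < N + 1 := by nlinarith
  have h10 : c ^ 2 * (2 / c ^ 2 * p) < c ^ 2 * (N + 1) := by gcongr
  linarith

theorem exists_isPowerFree_iff (hF : IsHeight α s F) :
    (∃ β : ℝ, 2 ≤ β ∧ IsPowerFree s β) ↔ IsBadlyApproximable α :=
  ⟨fun ⟨_, hβ, h⟩ => by_contra fun hbad => hF.not_isPowerFree hbad hβ h, hF.exists_isPowerFree⟩

end IsHeight

end SturmianAbelian

theorem mainTheorem6 (α : ℝ) (s : ℕ → SturmianAbelian.Letter)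
    (hs : SturmianAbelian.IsSturmianWord α s) :
    SturmianAbelian.abelianCriticalExponent s = SturmianAbelian.abelianCriticalExponentRep s ∧
    List.TFAE [
      SturmianAbelian.abelianCriticalExponent s < ⊤,
      ∃ β : ℝ, 2 ≤ β ∧ SturmianAbelian.IsPowerFree s β,
      SturmianAbelian.HasBoundedPartialQuotients α] := by
  obtain ⟨F, hF⟩ := hs.exists_isHeight
  refine ⟨SturmianAbelian.abelianCriticalExponent_eq_abelianCriticalExponentRep s, ?_⟩
  tfae_have 1 ↔ 2 := hF.abelianCriticalExponent_lt_top_iff.trans hF.exists_isPowerFree_iff.symm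
  tfae_have 1 ↔ 3 := hF.abelianCriticalExponent_lt_top_iff.trans
    ⟨SturmianAbelian.hasBoundedPartialQuotients_of_isBadlyApproximable hs.1,
      SturmianAbelian.isBadlyApproximable_of_hasBoundedPartialQuotients hs.1⟩
  tfae_finish
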